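/- For a complex polynomial $f$ of degree at least $2$ let $K_f$ be the set of points $z \in \mathbb{C}$ whose forward orbit under $f$ is bounded, and let $J_f = \partial K_f$ be its Julia set. Let $f(z) = az^n + \dots$ be a polynomial of degree $n \ge 2$ that is centered, that is, whose coefficient of $z^{n-1}$ is $0$, and let $\Sigma = \{c \in \mathbb{C} \mid cJ_f = J_f\}$ be the group of rotational symmetries of $J_f$. If $g(z) = bz^n + \dots$ is a polynomial of the same degree $n$ with $J_g = J_f$, then $$g = \frac{b}{a} f \quad\text{and}\quad \frac{b}{a} \in \Sigma.$$ Moreover, $\{g \mid \deg g = n,\ J_g = J_f\} = \{\sigma f \mid \sigma \in \Sigma\}$. -/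

import Mathlib

/-- The filled-in Julia set `K_f` of a complex polynomial: the points of `ℂ` whose forward orbit
under `f` is bounded. -/
def filledJuliaSet (f : Polynomial ℂ) : Set ℂ :=
  {z | Bornology.IsBounded (Set.range fun k : ℕ => (fun w : ℂ => f.eval w)^[k] z)}

/-- The Julia set `J_f = ∂K_f` of a complex polynomial. -/
def juliaSet (f : Polynomial ℂ) : Set ℂ :=
  frontier (filledJuliaSet f)

/-- A polynomial `∑ c_i z^i` of degree `d` is centered if `c_{d-1} = 0`. -/
def IsCentered (f : Polynomial ℂ) : Prop :=
  f.nextCoeff = 0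

/-- The group `Σ = {c ∈ ℂ | cJ = J}` of rotational symmetries of the Julia set `J` of a centered
polynomial `f`, as a set of complex numbers. -/
def rotationalSymmetries (f : Polynomial ℂ) : Set ℂ :=
  {c | (fun z : ℂ => c * z) '' juliaSet f = juliaSet f}

/-- The set `S_m` of polynomials of degree `m` with the same Julia set as `f`. -/
def sameJuliaOfDegree (f : Polynomial ℂ) (m : ℕ) : Set (Polynomial ℂ) :=
  {g | g.natDegree = m ∧ juliaSet g = juliaSet f}

open Polynomial

/-! The maximum principle recovers K_f from J_f, so f and g share a compact, completely invariant
set K. Let ζ and r be the centre and radius of its smallest enclosing disc. Averaging a polynomial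
p, with the degree n and leading coefficient of f, over the fibre of f above w gives w - c with c
independent of w; hence sup_K |p| ≥ r, with equality only for p = f - ζ
(`eq_sub_C_of_norm_eval_le`). A multiple of g - ζ is also extremal, so g = cf + d with |c| = 1 and d
= (1 - c)ζ (`exists_center_of_preimage_eq`). The map T(w) = cw + d then preserves K. The same
rigidity for f and f ∘ T, read at z^{n-1}, gives d = 0 because f is centered. Conversely, for σ ∈ Σ
it gives f(σz) = σ^n f(z) with |σ| = 1, so f and σf have orbits of equal moduli. -/

/-! ### Smallest enclosing discs. -/

theorem exists_minimal_enclosing_disc {K : Set ℂ} (hK : IsCompact K) (hne : K.Nonempty) :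
    ∃ (ζ : ℂ) (r : ℝ), (∀ w ∈ K, ‖w - ζ‖ ≤ r) ∧ ∀ c : ℂ, ∃ w ∈ K, r ≤ ‖w - c‖ := by
  obtain ⟨w₀, hw₀⟩ := hne
  obtain ⟨R, hR⟩ := hK.isBounded.subset_closedBall w₀
  have hR0 : 0 ≤ R := by simpa using hR hw₀
  -- A disc of radius at most `R` containing `w₀` has its centre within `R` of `w₀`, so this compact
  -- truncation loses no relevant competitor.
  let S : Set (ℂ × ℝ) := (Metric.closedBall w₀ R ×ˢ Set.Icc 0 R) ∩ {x | ∀ w ∈ K, ‖w - x.1‖ ≤ x.2}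
  have hS : IsCompact S := by
    refine ((isCompact_closedBall w₀ R).prod isCompact_Icc).inter_right ?_
    simp only [Set.ofPred_forall]
    refine isClosed_biInter fun w _ => isClosed_le (by fun_prop) (by fun_prop)
  have hSne : S.Nonempty := by
    refine ⟨(w₀, R), ⟨by simpa using hR0, by simpa using hR0⟩, fun w hw => ?_⟩
    simpa [dist_eq_norm] using hR hw
  obtain ⟨⟨ζ, r⟩, hx, hmin⟩ := hS.exists_isMinOn hSne continuous_snd.continuousOn
  refine ⟨ζ, r, hx.2, fun c => ?_⟩
  by_contra! hc
  obtain ⟨w, hw, hmax⟩ := hK.exists_isMaxOn ⟨w₀, hw₀⟩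
    (f := fun w : ℂ => ‖w - c‖) (by fun_prop)
  have hle : ∀ v ∈ K, ‖v - c‖ ≤ ‖w - c‖ := fun v hv => hmax hv
  have hrR : r ≤ R := hx.1.2.2
  have hmem : (c, ‖w - c‖) ∈ S := by
    refine ⟨⟨?_, norm_nonneg _, ((hc w hw).trans_le hrR).le⟩, hle⟩
    rw [mem_closedBall_iff_norm, norm_sub_rev]
    exact ((hc w₀ hw₀).trans_le hrR).le
  exact absurd (hmin hmem) (not_le.2 (hc w hw))

/-- A nontrivial compact set has a unique smallest enclosing disc, and at least two of its points
lie on the bounding circle. -/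
theorem exists_circumcenter {K : Set ℂ} (hK : IsCompact K) (hK' : K.Nontrivial) :
    ∃ (ζ : ℂ) (r : ℝ), 0 < r ∧ (∀ w ∈ K, ‖w - ζ‖ ≤ r) ∧ (∀ c : ℂ, ∃ w ∈ K, r ≤ ‖w - c‖) ∧
      (∀ c : ℂ, (∀ w ∈ K, ‖w - c‖ ≤ r) → c = ζ) ∧
      ∃ w₁ ∈ K, ∃ w₂ ∈ K, w₁ ≠ w₂ ∧ ‖w₁ - ζ‖ = r ∧ ‖w₂ - ζ‖ = r := by
  obtain ⟨ζ, r, hζ, hr⟩ := exists_minimal_enclosing_disc hK hK'.nonempty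
  obtain ⟨w₁, hw₁, hrw₁⟩ := hr ζ
  have hw₁r : ‖w₁ - ζ‖ = r := le_antisymm (hζ _ hw₁) hrw₁
  have hr0 : 0 < r := by
    obtain ⟨u, hu, v, hv, huv⟩ := hK'
    by_contra! h
    have h1 : u - ζ = 0 := norm_le_zero_iff.1 ((hζ u hu).trans h)
    have h2 : v - ζ = 0 := norm_le_zero_iff.1 ((hζ v hv).trans h)
    exact huv (by rw [sub_eq_zero.1 h1, sub_eq_zero.1 h2])
  refine ⟨ζ, r, hr0, hζ, hr, fun c hc => ?_, ?_⟩
  · obtain ⟨w, hw, hwr⟩ := hr ((c + ζ) / 2)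
    have h1 := hc w hw
    have h2 := hζ w hw
    have h3 := parallelogram_law_with_norm ℝ (w - c) (w - ζ)
    rw [show w - c + (w - ζ) = (2 : ℝ) • (w - (c + ζ) / 2) by
      rw [Complex.real_smul]; push_cast; ring, show w - c - (w - ζ) = ζ - c by ring, norm_smul,
      Real.norm_of_nonneg zero_le_two] at h3
    have h4 : ‖ζ - c‖ = 0 := by
      have := norm_nonneg (ζ - c)
      have := norm_nonneg (w - c)
      have := norm_nonneg (w - ζ)
      nlinarith
    exact (sub_eq_zero.1 (norm_eq_zero.1 h4)).symm
  · refine ⟨w₁, hw₁, ?_⟩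
    by_contra! hcon
    have hlt : ∀ w ∈ K, w ≠ w₁ → ‖w - ζ‖ < r := fun w hw hne =>
      lt_of_le_of_ne (hζ w hw) (hcon w hw hne.symm hw₁r)
    -- If `w₁` were alone on the circle, moving the centre slightly towards it would shrink the
    -- disc: `K'` has slack by compactness, and the rest of `K` lies on the side of `w₁`.
    set K' : Set ℂ := K ∩ {w | inner ℝ (w - ζ) (w₁ - ζ) ≤ r ^ 2 / 2} with hKdef
    have hK'c : IsCompact K' :=
      hK.inter_right (isClosed_le (by fun_prop) (by fun_prop))
    have hne : ∀ w ∈ K', w ≠ w₁ := by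
      rintro w ⟨-, hw⟩ rfl
      rw [Set.mem_ofPred_eq, real_inner_self_eq_norm_sq, hw₁r] at hw
      nlinarith
    obtain ⟨s, hsr, hs⟩ : ∃ s < r, ∀ w ∈ K', ‖w - ζ‖ ≤ s := by
      rcases K'.eq_empty_or_nonempty with he | hne'
      · exact ⟨0, hr0, by simp [he]⟩
      · obtain ⟨w, hw, hmax⟩ := hK'c.exists_isMaxOn hne'
          (f := fun w : ℂ => ‖w - ζ‖) (by fun_prop)
        exact ⟨_, hlt w hw.1 (hne w hw), fun v hv => hmax hv⟩
    obtain ⟨ε, hε0, hε1, hε2⟩ : ∃ ε : ℝ, 0 < ε ∧ ε < 1 ∧ s + ε * r < r := by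
      refine ⟨min (1 / 2) ((r - s) / (2 * r)), ?_, ?_, ?_⟩
      · have : 0 < r - s := by linarith
        positivity
      · exact (min_le_left _ _).trans_lt (by norm_num)
      · have h := mul_le_mul_of_nonneg_right (min_le_right (1 / 2) ((r - s) / (2 * r))) hr0.le
        have h' : (r - s) / (2 * r) * r = (r - s) / 2 := by field_simp
        linarith
    obtain ⟨w, hw, hwr⟩ := hr (ζ + ε • (w₁ - ζ))
    rw [← sub_sub] at hwr
    by_cases hwK : w ∈ K'
    · have h1 := norm_sub_le (w - ζ) (ε • (w₁ - ζ))
      rw [norm_smul, hw₁r, Real.norm_of_nonneg hε0.le] at h1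
      linarith [hs w hwK]
    · have h2 : r ^ 2 / 2 < inner ℝ (w - ζ) (w₁ - ζ) := by
        by_contra! h
        exact hwK ⟨hw, h⟩
      have h1 := norm_sub_sq_real (w - ζ) (ε • (w₁ - ζ))
      rw [norm_smul, hw₁r, Real.norm_of_nonneg hε0.le, real_inner_smul_right] at h1
      have h3 : ‖w - ζ‖ ^ 2 ≤ r ^ 2 := pow_le_pow_left₀ (norm_nonneg _) (hζ w hw) 2
      have h4 : r ^ 2 ≤ ‖w - ζ - ε • (w₁ - ζ)‖ ^ 2 := pow_le_pow_left₀ hr0.le hwr 2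
      have h5 : ε * (r ^ 2 / 2) < ε * inner ℝ (w - ζ) (w₁ - ζ) := mul_lt_mul_of_pos_left h2 hε0
      have h6 : ε ^ 2 * r ^ 2 < ε * r ^ 2 := by
        have : ε * ε * r ^ 2 < 1 * ε * r ^ 2 := by gcongr
        nlinarith
      nlinarith

/-! ### Power sums and sums over polynomial fibres. -/

theorem sum_pow_eq_of_esymm_eq {n : ℕ} (f g : Fin n → ℂ)
    (h : ∀ j < n, (Finset.univ.val.map f).esymm j = (Finset.univ.val.map g).esymm j) :
    ∀ m < n, ∑ i, f i ^ m = ∑ i, g i ^ m := by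
  have key : ∀ (f : Fin n → ℂ) (k : ℕ), 0 < k → ∑ i, f i ^ k =
      (-1) ^ (k + 1) * k * (Finset.univ.val.map f).esymm k -
      ∑ a ∈ Finset.HasAntidiagonal.antidiagonal k with a.1 ∈ Set.Ioo 0 k,
        (-1) ^ a.1 * (Finset.univ.val.map f).esymm a.1 * ∑ i, f i ^ a.2 := by
    intro f k hk
    have := congrArg (MvPolynomial.aeval f) (MvPolynomial.psum_eq_mul_esymm_sub_sum (Fin n) ℂ k hk)
    simpa only [MvPolynomial.psum, MvPolynomial.aeval_esymm_eq_multiset_esymm, map_sub, map_mul,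
      map_pow, map_neg, map_one, map_natCast, map_sum, MvPolynomial.aeval_X] using this
  intro m
  induction m using Nat.strong_induction_on with
  | _ m ih =>
    intro hm
    rcases Nat.eq_zero_or_pos m with rfl | hm0
    · simp
    · rw [key f m hm0, key g m hm0, h m hm]
      congr 1
      refine Finset.sum_congr rfl fun a ha => ?_
      simp only [Finset.mem_filter, Finset.HasAntidiagonal.mem_antidiagonal, Set.mem_Ioo] at ha
      rw [h a.1 (by omega), ih a.2 (by omega) (by omega)]

theorem Multiset.sum_map_pow_eq_of_esymm_eq {s t : Multiset ℂ} (hcard : s.card = t.card)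
    (h : ∀ j < s.card, s.esymm j = t.esymm j) {m : ℕ} (hm : m < s.card) :
    (s.map (· ^ m)).sum = (t.map (· ^ m)).sum := by
  have hex : ∀ s : Multiset ℂ, ∀ n, s.card = n → ∃ f : Fin n → ℂ, s = Finset.univ.val.map f := by
    intro s n hn
    obtain rfl : s.toList.length = n := by rw [Multiset.length_toList, hn]
    exact ⟨s.toList.get, by rw [Fin.univ_val_map, List.ofFn_get, Multiset.coe_toList]⟩
  obtain ⟨f, hf⟩ := hex s _ rfl
  obtain ⟨g, hg⟩ := hex t _ hcard.symm
  have := sum_pow_eq_of_esymm_eq f g (fun j hj => by rw [← hf, ← hg]; exact h j hj) m hm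
  rw [hf, hg, Multiset.map_map, Multiset.map_map]
  exact this

theorem Polynomial.card_roots_eq_natDegree (P : ℂ[X]) : P.roots.card = P.natDegree :=
  (IsAlgClosed.splits P).natDegree_eq_card_roots.symm

/-- Subtracting a constant changes only the top elementary symmetric function of the roots, which by
Newton's identities does not enter lower power sums. -/
theorem Polynomial.sum_roots_pow_sub_C (P : ℂ[X]) (w : ℂ) {m : ℕ} (hm : m < P.natDegree) :
    ((P - C w).roots.map (· ^ m)).sum = (P.roots.map (· ^ m)).sum := by
  have hdeg : (P - C w).natDegree = P.natDegree := natDegree_sub_C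
  have hlc : (P - C w).leadingCoeff = P.leadingCoeff := by
    rw [leadingCoeff, hdeg, coeff_sub, coeff_C_of_ne_zero (by omega), sub_zero, leadingCoeff]
  have hP : P.leadingCoeff ≠ 0 := leadingCoeff_ne_zero.2 (by rintro rfl; simp at hm)
  refine Multiset.sum_map_pow_eq_of_esymm_eq ?_ (fun j hj => ?_) ?_
  · rw [card_roots_eq_natDegree, card_roots_eq_natDegree, hdeg]
  · rw [card_roots_eq_natDegree, hdeg] at hj
    have h1 := coeff_eq_esymm_roots_of_card (card_roots_eq_natDegree P)
      (k := P.natDegree - j) (by omega)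
    have h2 := coeff_eq_esymm_roots_of_card (card_roots_eq_natDegree (P - C w))
      (k := P.natDegree - j) (by omega)
    rw [coeff_sub, coeff_C_of_ne_zero (by omega), sub_zero, hlc, hdeg, h1] at h2
    rw [show P.natDegree - (P.natDegree - j) = j by omega] at h2
    exact (mul_left_cancel₀ (mul_ne_zero hP (pow_ne_zero _ (by norm_num))) h2).symm
  · rw [card_roots_eq_natDegree, hdeg]; exact hm

theorem Polynomial.sum_map_eval (q : ℂ[X]) (s : Multiset ℂ) :
    (s.map (q.eval ·)).sum =
      ∑ i ∈ Finset.range (q.natDegree + 1), q.coeff i * (s.map (· ^ i)).sum := by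
  induction s using Multiset.induction_on with
  | empty => simp
  | cons a s ih =>
    simp only [Multiset.map_cons, Multiset.sum_cons, ih, mul_add, Finset.sum_add_distrib]
    rw [eval_eq_sum_range]

theorem Polynomial.sum_roots_eval_sub_C (P q : ℂ[X]) (w : ℂ) (hq : q.natDegree < P.natDegree) :
    ((P - C w).roots.map (q.eval ·)).sum = (P.roots.map (q.eval ·)).sum := by
  rw [sum_map_eval, sum_map_eval]
  refine Finset.sum_congr rfl fun i hi => ?_
  rw [sum_roots_pow_sub_C P w]
  have := Finset.mem_range.1 hi
  omega

/-- The average over the fibre of `P` above `w` of a polynomial with the degree and leading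
coefficient of `P` is a translate of `w`. -/
theorem Polynomial.exists_sum_roots_sub_C_eq {P p : ℂ[X]} (hP : 0 < P.natDegree)
    (hp : (p - P).natDegree < P.natDegree) :
    ∃ c : ℂ, ∀ w, ((P - C w).roots.map (p.eval ·)).sum = P.natDegree * (w - c) := by
  refine ⟨-(P.roots.map ((p - P).eval ·)).sum / P.natDegree, fun w => ?_⟩
  have hn : (P.natDegree : ℂ) ≠ 0 := by exact_mod_cast hP.ne'
  have h1 : (P - C w).roots.map (p.eval ·) =
      (P - C w).roots.map (fun z => w + (p - P).eval z) := by
    refine Multiset.map_congr rfl fun z hz => ?_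
    have : eval z P - w = 0 := by simpa using isRoot_of_mem_roots hz
    rw [eval_sub, sub_eq_zero.1 this]; ring
  rw [h1, Multiset.sum_map_add, sum_roots_eval_sub_C P _ w hp, Multiset.map_const',
    Multiset.sum_replicate, card_roots_eq_natDegree, natDegree_sub_C, nsmul_eq_mul]
  field_simp
  ring

/-- Differentiation lowers the multiplicity of a root by at most one, and `d` supplies the missing
factor. -/
theorem Polynomial.dvd_mul_derivative_of_forall_root {Q d : ℂ[X]} (hQ : Q.derivative ≠ 0)
    (h : ∀ z, Q.IsRoot z → d.IsRoot z) : Q ∣ d * Q.derivative := by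
  classical
  rcases eq_or_ne d 0 with rfl | hd
  · simp
  have hQ0 : Q ≠ 0 := by rintro rfl; simp at hQ
  refine (IsAlgClosed.splits Q).dvd_of_roots_le_roots hQ0 (Multiset.le_iff_count.2 fun z => ?_)
  rw [count_roots, count_roots, rootMultiplicity_mul (mul_ne_zero hd hQ)]
  by_cases hz : Q.IsRoot z
  · have h1 := (rootMultiplicity_pos hd).2 (h z hz)
    have h2 := rootMultiplicity_sub_one_le_derivative_rootMultiplicity Q z
    omega
  · rw [rootMultiplicity_eq_zero hz]; omega

/-- Otherwise the coprime factors P - w₁ and P - w₂ both divide dP', whose degree is less than 2 deg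
P. -/
theorem Polynomial.eq_zero_of_vanishing_on_two_fibres {P d : ℂ[X]} {w₁ w₂ : ℂ} (hw : w₁ ≠ w₂)
    (hd : d.natDegree < P.natDegree) (h₁ : ∀ z, P.eval z = w₁ → d.eval z = 0)
    (h₂ : ∀ z, P.eval z = w₂ → d.eval z = 0) : d = 0 := by
  by_contra hd0
  have hP' : P.derivative ≠ 0 := fun h => by
    have := derivative_eq_zero.1 h
    omega
  have key : ∀ w, (∀ z, P.eval z = w → d.eval z = 0) → P - C w ∣ d * P.derivative := by
    intro w h
    have h' := dvd_mul_derivative_of_forall_root (Q := P - C w) (d := d) (by simpa using hP')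
      (fun z hz => h z (sub_eq_zero.1 (by simpa using hz)))
    simpa using h'
  have hcop : IsCoprime (P - C w₁) (P - C w₂) := by
    have hne : w₂ - w₁ ≠ 0 := sub_ne_zero.2 hw.symm
    refine ⟨C (w₂ - w₁)⁻¹, -C (w₂ - w₁)⁻¹, ?_⟩
    have : C (w₂ - w₁)⁻¹ * C (w₂ - w₁) = 1 := by rw [← C_mul, inv_mul_cancel₀ hne, C_1]
    rw [C_sub] at this
    linear_combination this
  have hdvd := natDegree_le_of_dvd (hcop.mul_dvd (key _ h₁) (key _ h₂)) (mul_ne_zero hd0 hP')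
  have hne : ∀ w, P - C w ≠ 0 := fun w h => by
    have : (P - C w).natDegree = P.natDegree := natDegree_sub_C
    rw [h, natDegree_zero] at this
    omega
  rw [natDegree_mul (hne _) (hne _), natDegree_mul hd0 hP', natDegree_sub_C, natDegree_sub_C] at hdvd
  have := natDegree_derivative_le P
  omega

/-! ### Polynomials of least deviation on an invariant compact set. -/

theorem Multiset.norm_sum_le_card_mul {s : Multiset ℂ} {r : ℝ} (h : ∀ x ∈ s, ‖x‖ ≤ r) :
    ‖s.sum‖ ≤ s.card * r := by
  refine (norm_multiset_sum_le s).trans ?_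
  have := Multiset.sum_le_card_nsmul (s.map norm) r (by simpa using h)
  simpa using this

theorem Multiset.eq_of_sum_eq_card_mul {s : Multiset ℂ} {r : ℝ} {v : ℂ} (h : ∀ x ∈ s, ‖x‖ ≤ r)
    (hv : ‖v‖ = r) (hsum : s.sum = s.card * v) {x : ℂ} (hx : x ∈ s) : x = v := by
  obtain ⟨t, rfl⟩ := Multiset.exists_cons_of_mem hx
  have ht := norm_sum_le_card_mul (s := t) (r := r) fun y hy => h y (Multiset.mem_cons_of_mem hy)
  have hxr := h x hx
  rw [Multiset.sum_cons, Multiset.card_cons] at hsum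
  have hts : t.sum = ((t.card : ℝ) + 1) • v - x := by
    rw [Complex.real_smul]; push_cast at hsum ⊢; linear_combination hsum
  set k : ℝ := (Multiset.card t : ℝ) with hk
  have hk0 : 0 ≤ k := Nat.cast_nonneg _
  have h1 := norm_sub_sq_real ((k + 1) • v) x
  rw [← hts, norm_smul, Real.norm_of_nonneg (by linarith), real_inner_smul_left, hv] at h1
  have h2 := norm_sub_sq_real v x
  have h3 : ‖t.sum‖ ^ 2 ≤ (k * r) ^ 2 := pow_le_pow_left₀ (norm_nonneg _) ht 2
  have h4 : ‖x‖ ^ 2 ≤ r ^ 2 := pow_le_pow_left₀ (norm_nonneg _) hxr 2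
  -- Expanding |(k + 1)v - x|² ≤ k²r² bounds the left side by k(|x|² - r²).
  have h5 : (k + 1) * ‖v - x‖ ^ 2 ≤ 0 := by
    rw [hv] at h2
    rw [h2]
    nlinarith
  have h6 : ‖v - x‖ ^ 2 ≤ 0 := by
    by_contra! hcon
    have : 0 < (k + 1) * ‖v - x‖ ^ 2 := by positivity
    linarith
  have h7 : ‖v - x‖ = 0 := by
    have := norm_nonneg (v - x)
    nlinarith
  exact (sub_eq_zero.1 (norm_eq_zero.1 h7)).symm

theorem Polynomial.exists_le_norm_eval_of_preimage_eq {K : Set ℂ} (hK : IsCompact K)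
    {r : ℝ} (hmin : ∀ c : ℂ, ∃ w ∈ K, r ≤ ‖w - c‖) {P p : ℂ[X]} (hP : 0 < P.natDegree)
    (hPK : ∀ z, P.eval z ∈ K ↔ z ∈ K) (hp : (p - P).natDegree < P.natDegree) :
    ∃ z ∈ K, r ≤ ‖p.eval z‖ := by
  obtain ⟨c, hc⟩ := exists_sum_roots_sub_C_eq hP hp
  obtain ⟨w, hw, hwr⟩ := hmin c
  obtain ⟨z₀, hz₀, hmax⟩ := hK.exists_isMaxOn ⟨w, hw⟩ (f := fun z => ‖p.eval z‖) (by fun_prop)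
  refine ⟨z₀, hz₀, hwr.trans ?_⟩
  have h := Multiset.norm_sum_le_card_mul (s := (P - C w).roots.map (p.eval ·))
    (r := ‖p.eval z₀‖) (by
      intro x hx
      obtain ⟨z, hz, rfl⟩ := Multiset.mem_map.1 hx
      have hPz : P.eval z - w = 0 := by simpa using isRoot_of_mem_roots hz
      exact hmax ((hPK z).1 (by rwa [sub_eq_zero.1 hPz])))
  rw [hc w, Multiset.card_map, card_roots_eq_natDegree, natDegree_sub_C, norm_mul,
    Complex.norm_natCast] at h
  exact le_of_mul_le_mul_left h (by exact_mod_cast hP)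

/-- If `K` is completely invariant under `P`, then `P - ζ`, for `ζ` the circumcenter of `K`, is the
only polynomial of least deviation from zero on `K` with its degree and leading coefficient. -/
theorem Polynomial.eq_sub_C_of_norm_eval_le {K : Set ℂ} {ζ : ℂ} {r : ℝ}
    (huniq : ∀ c : ℂ, (∀ w ∈ K, ‖w - c‖ ≤ r) → c = ζ)
    (htwo : ∃ w₁ ∈ K, ∃ w₂ ∈ K, w₁ ≠ w₂ ∧ ‖w₁ - ζ‖ = r ∧ ‖w₂ - ζ‖ = r)
    {P p : ℂ[X]} (hP : 0 < P.natDegree) (hPK : ∀ z, P.eval z ∈ K ↔ z ∈ K)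
    (hp : (p - P).natDegree < P.natDegree) (hle : ∀ z ∈ K, ‖p.eval z‖ ≤ r) :
    p = P - C ζ := by
  obtain ⟨c, hc⟩ := exists_sum_roots_sub_C_eq hP hp
  have hfib : ∀ w ∈ K, ∀ x ∈ (P - C w).roots.map (p.eval ·), ‖x‖ ≤ r := by
    intro w hw x hx
    obtain ⟨z, hz, rfl⟩ := Multiset.mem_map.1 hx
    have hPz : P.eval z - w = 0 := by simpa using isRoot_of_mem_roots hz
    exact hle z ((hPK z).1 (by rwa [sub_eq_zero.1 hPz]))
  have hcard : ∀ w, ((P - C w).roots.map (p.eval ·)).card = P.natDegree := fun w => by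
    rw [Multiset.card_map, card_roots_eq_natDegree, natDegree_sub_C]
  obtain rfl : c = ζ := huniq c fun w hw => by
    have h := Multiset.norm_sum_le_card_mul (hfib w hw)
    rw [hc w, hcard, norm_mul, Complex.norm_natCast] at h
    exact le_of_mul_le_mul_left h (by exact_mod_cast hP)
  have hval : ∀ w ∈ K, ‖w - c‖ = r → ∀ z, P.eval z = w → (p - (P - C c)).eval z = 0 := by
    intro w hw hwr z hz
    have hne : P - C w ≠ 0 := fun h => by
      have : (P - C w).natDegree = P.natDegree := natDegree_sub_C
      rw [h, natDegree_zero] at this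
      omega
    have hz' : z ∈ (P - C w).roots := (mem_roots hne).2 (by simp [hz])
    have := Multiset.eq_of_sum_eq_card_mul (hfib w hw) hwr (by rw [hc w, hcard])
      (Multiset.mem_map_of_mem _ hz')
    simp only [eval_sub, eval_C, hz]
    rw [this]; ring
  obtain ⟨w₁, hw₁, w₂, hw₂, hne, hr₁, hr₂⟩ := htwo
  refine sub_eq_zero.1 (eq_zero_of_vanishing_on_two_fibres hne ?_ (hval w₁ hw₁ hr₁)
    (hval w₂ hw₂ hr₂))
  rw [← sub_add, natDegree_add_C]
  exact hp

/-- Two polynomials of the same degree for which `K` is completely invariant differ by a rotation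
about the circumcenter of `K`. -/
theorem Polynomial.exists_center_of_preimage_eq {K : Set ℂ} (hK : IsCompact K)
    (hK' : K.Nontrivial) :
    ∃ ζ : ℂ, (∀ c : ℂ, ‖c‖ = 1 → (∀ w ∈ K, c * w ∈ K) → c * ζ = ζ) ∧
      ∀ P Q : ℂ[X], 0 < P.natDegree → Q.natDegree = P.natDegree →
      (∀ z, P.eval z ∈ K ↔ z ∈ K) → (∀ z, Q.eval z ∈ K ↔ z ∈ K) →
      ‖Q.leadingCoeff / P.leadingCoeff‖ = 1 ∧
        Q - C ζ = C (Q.leadingCoeff / P.leadingCoeff) * (P - C ζ) := by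
  obtain ⟨ζ, r, hr0, hζ, hmin, huniq, htwo⟩ := exists_circumcenter hK hK'
  refine ⟨ζ, fun c hc hcK => ?_, ?_⟩
  · have hc0 : c ≠ 0 := by rintro rfl; simp at hc
    have h : c⁻¹ * ζ = ζ := huniq _ fun w hw => by
      have h1 := hζ _ (hcK w hw)
      rwa [show c * w - ζ = c * (w - c⁻¹ * ζ) by field_simp, norm_mul, hc, one_mul] at h1
    rw [← h, mul_inv_cancel_left₀ hc0, h]
  have hdeg : ∀ P Q : ℂ[X], 0 < P.natDegree → Q.natDegree = P.natDegree →
      (C (P.leadingCoeff / Q.leadingCoeff) * (Q - C ζ) - P).natDegree < P.natDegree := by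
    intro P Q hP hQ
    have hQ0 : Q.leadingCoeff ≠ 0 := leadingCoeff_ne_zero.2 (by rintro rfl; simp at hQ; omega)
    refine lt_of_le_of_ne ?_ fun heq => ?_
    · refine (natDegree_sub_le _ _).trans (max_le ((natDegree_C_mul_le _ _).trans ?_) le_rfl)
      rw [natDegree_sub_C, hQ]
    · have h0 : (C (P.leadingCoeff / Q.leadingCoeff) * (Q - C ζ) - P).coeff P.natDegree = 0 := by
        rw [coeff_sub, coeff_C_mul, coeff_sub, coeff_C_of_ne_zero hP.ne', sub_zero, ← hQ,
          coeff_natDegree, div_mul_cancel₀ _ hQ0, hQ, coeff_natDegree, sub_self]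
      rw [← heq, coeff_natDegree, leadingCoeff_eq_zero] at h0
      rw [h0, natDegree_zero] at heq
      omega
  -- The rescaled Q - ζ competes with P - ζ, so its supremum on `K` is at least r; but |Q - ζ| ≤ r
  -- there. Exchanging P and Q gives modulus one.
  have hnorm : ∀ P Q : ℂ[X], 0 < P.natDegree → Q.natDegree = P.natDegree →
      (∀ z, P.eval z ∈ K ↔ z ∈ K) → (∀ z, Q.eval z ∈ K ↔ z ∈ K) →
      1 ≤ ‖P.leadingCoeff / Q.leadingCoeff‖ := by
    intro P Q hP hQ hPK hQK
    obtain ⟨z, hz, hzr⟩ := exists_le_norm_eval_of_preimage_eq hK hmin hP hPK (hdeg P Q hP hQ)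
    rw [eval_mul, eval_C, eval_sub, eval_C, norm_mul] at hzr
    have h1 := hζ _ ((hQK z).2 hz)
    have h2 := mul_le_mul_of_nonneg_left h1 (norm_nonneg (P.leadingCoeff / Q.leadingCoeff))
    nlinarith
  intro P Q hP hQ hPK hQK
  have hlc : ‖Q.leadingCoeff / P.leadingCoeff‖ = 1 := by
    refine le_antisymm ?_ (hnorm Q P (hQ ▸ hP) hQ.symm hQK hPK)
    have := hnorm P Q hP hQ hPK hQK
    rw [← inv_div, norm_inv]
    exact inv_le_one_of_one_le₀ this
  refine ⟨hlc, (eq_sub_C_of_norm_eval_le huniq htwo (hQ ▸ hP) hQK (hdeg Q P (hQ ▸ hP) hQ.symm)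
    fun z hz => ?_).symm⟩
  rw [eval_mul, eval_C, norm_mul, hlc, one_mul, eval_sub, eval_C]
  exact hζ _ ((hPK z).2 hz)

/-! ### Filled Julia sets and the maximum principle. -/

theorem eval_mem_filledJuliaSet (f : ℂ[X]) (z : ℂ) :
    f.eval z ∈ filledJuliaSet f ↔ z ∈ filledJuliaSet f := by
  have h : (Set.range fun k : ℕ => (fun w : ℂ => f.eval w)^[k] z) =
      insert z (Set.range fun k : ℕ => (fun w : ℂ => f.eval w)^[k] (f.eval z)) := by
    ext x
    simp only [Set.mem_range, Set.mem_insert_iff]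
    constructor
    · rintro ⟨k | k, rfl⟩
      · exact Or.inl rfl
      · exact Or.inr ⟨k, rfl⟩
    · rintro (rfl | ⟨k, rfl⟩)
      · exact ⟨0, rfl⟩
      · exact ⟨k + 1, rfl⟩
  simp only [filledJuliaSet, Set.mem_ofPred_eq]
  rw [h, Bornology.isBounded_insert]

theorem mem_filledJuliaSet_iff_exists_bound (f : ℂ[X]) (z : ℂ) :
    z ∈ filledJuliaSet f ↔ ∃ M : ℝ, ∀ k : ℕ, ‖(fun w : ℂ => f.eval w)^[k] z‖ ≤ M := by
  simp only [filledJuliaSet, Set.mem_ofPred_eq, isBounded_iff_forall_norm_le, Set.forall_mem_range]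

theorem exists_escape_radius {f : ℂ[X]} (hf : 2 ≤ f.natDegree) :
    ∃ R : ℝ, 0 < R ∧ ∀ z : ℂ, R < ‖z‖ → 2 * ‖z‖ ≤ ‖f.eval z‖ := by
  have hdeg : 0 < f.divX.degree := by
    rw [← natDegree_pos_iff_degree_pos, natDegree_divX_eq_natDegree_tsub_one]
    omega
  have ht := f.divX.tendsto_norm_atTop hdeg (l := Bornology.cobounded ℂ) (z := id)
    tendsto_norm_cobounded_atTop
  have hev := ht.eventually_ge_atTop (2 + ‖f.coeff 0‖)
  rw [← comap_norm_atTop, (Filter.atTop_basis_Ioi.comap _).eventually_iff] at hev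
  obtain ⟨R, -, hR⟩ := hev
  refine ⟨max R 1, by positivity, fun z hz => ?_⟩
  have h1 : 2 + ‖f.coeff 0‖ ≤ ‖f.divX.eval z‖ := hR ((le_max_left _ _).trans_lt hz)
  have h2 : 1 < ‖z‖ := (le_max_right _ _).trans_lt hz
  have h3 : f.eval z = f.divX.eval z * z + f.coeff 0 := by
    conv_lhs => rw [← f.divX_mul_X_add]
    simp
  rw [h3]
  have h4 := norm_sub_le (f.divX.eval z * z + f.coeff 0) (f.coeff 0)
  rw [add_sub_cancel_right, norm_mul] at h4
  nlinarith [norm_nonneg (f.coeff 0)]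

/-- An orbit that passes the escape radius doubles at each step. The uniform bound yields
compactness and is what the maximum principle transfers. -/
theorem exists_mem_filledJuliaSet_iff {f : ℂ[X]} (hf : 2 ≤ f.natDegree) :
    ∃ R : ℝ, ∀ z, z ∈ filledJuliaSet f ↔ ∀ k : ℕ, ‖(fun w : ℂ => f.eval w)^[k] z‖ ≤ R := by
  obtain ⟨R, hR0, hR⟩ := exists_escape_radius hf
  refine ⟨R, fun z => ⟨fun hz k => ?_, fun h => ?_⟩⟩
  · by_contra! hk
    have hgrow : ∀ j : ℕ, 2 ^ j * R < ‖(fun w : ℂ => f.eval w)^[k + j] z‖ := by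
      intro j
      induction j with
      | zero => simpa using hk
      | succ j ih =>
        rw [← add_assoc, Function.iterate_succ_apply']
        have h1 : R ≤ 2 ^ j * R := le_mul_of_one_le_left hR0.le (one_le_pow₀ one_le_two)
        have h2 := hR _ (h1.trans_lt ih)
        rw [pow_succ]
        linarith
    obtain ⟨M, hM⟩ := (mem_filledJuliaSet_iff_exists_bound f z).1 hz
    obtain ⟨j, hj⟩ := pow_unbounded_of_one_lt (M / R) (one_lt_two (α := ℝ))
    have h1 := hM (k + j)
    have h2 := hgrow j
    rw [div_lt_iff₀ hR0] at hj
    linarith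
  · exact (mem_filledJuliaSet_iff_exists_bound f z).2 ⟨R, h⟩

theorem continuous_iterate_eval (f : ℂ[X]) (k : ℕ) :
    Continuous (fun w : ℂ => f.eval w)^[k] :=
  f.continuous.iterate k

theorem isCompact_filledJuliaSet {f : ℂ[X]} (hf : 2 ≤ f.natDegree) :
    IsCompact (filledJuliaSet f) := by
  obtain ⟨R, hR⟩ := exists_mem_filledJuliaSet_iff hf
  refine Metric.isCompact_of_isClosed_isBounded ?_ ?_
  · have : filledJuliaSet f = ⋂ k : ℕ, {z | ‖(fun w : ℂ => f.eval w)^[k] z‖ ≤ R} := by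
      ext z
      simp [hR z]
    rw [this]
    exact isClosed_iInter fun k =>
      isClosed_le (continuous_iterate_eval f k).norm continuous_const
  · exact isBounded_iff_forall_norm_le.2 ⟨R, fun z hz => (hR z).1 hz 0⟩

theorem juliaSet_subset_filledJuliaSet {f : ℂ[X]} (hf : 2 ≤ f.natDegree) :
    juliaSet f ⊆ filledJuliaSet f :=
  (isCompact_filledJuliaSet hf).isClosed.frontier_subset

theorem norm_le_of_forall_mem_juliaSet {f : ℂ[X]} (hf : 2 ≤ f.natDegree) {p : ℂ → ℂ}
    (hp : Differentiable ℂ p) {M : ℝ} (h : ∀ z ∈ juliaSet f, ‖p z‖ ≤ M) {z : ℂ}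
    (hz : z ∈ filledJuliaSet f) : ‖p z‖ ≤ M :=
  Complex.norm_le_of_forall_mem_frontier_norm_le (isCompact_filledJuliaSet hf).isBounded
    hp.diffContOnCl h (subset_closure hz)

theorem differentiable_iterate_eval (f : ℂ[X]) (k : ℕ) :
    Differentiable ℂ (fun w : ℂ => f.eval w)^[k] :=
  f.differentiable.iterate k

/-- The filled Julia set is the polynomially convex hull of the Julia set. -/
theorem mem_filledJuliaSet_of_forall_mem_juliaSet {f g : ℂ[X]} (hf : 2 ≤ f.natDegree)
    (hg : 2 ≤ g.natDegree) {c : ℂ} (h : ∀ z ∈ juliaSet f, c * z ∈ filledJuliaSet g) {z : ℂ}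
    (hz : z ∈ filledJuliaSet f) : c * z ∈ filledJuliaSet g := by
  obtain ⟨R, hR⟩ := exists_mem_filledJuliaSet_iff hg
  -- Maximum principle for the entire function z ↦ g^k(cz).
  refine (hR _).2 fun k => norm_le_of_forall_mem_juliaSet hf
    (p := fun z => (fun w : ℂ => g.eval w)^[k] (c * z))
    ((differentiable_iterate_eval g k).comp (differentiable_id.const_mul c))
    (fun w hw => (hR _).1 (h w hw) k) hz

theorem filledJuliaSet_eq_of_juliaSet_eq {f g : ℂ[X]} (hf : 2 ≤ f.natDegree)
    (hg : 2 ≤ g.natDegree) (h : juliaSet f = juliaSet g) :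
    filledJuliaSet f = filledJuliaSet g := by
  have key : ∀ {f g : ℂ[X]}, 2 ≤ f.natDegree → 2 ≤ g.natDegree → juliaSet f = juliaSet g →
      filledJuliaSet f ⊆ filledJuliaSet g := fun hf hg h z hz => by
    have := mem_filledJuliaSet_of_forall_mem_juliaSet hf hg (c := 1) (fun w hw => by
      rw [one_mul]; exact juliaSet_subset_filledJuliaSet hg (h ▸ hw)) hz
    rwa [one_mul] at this
  exact (key hf hg h).antisymm (key hg hf h.symm)

theorem Polynomial.exists_eval_eq {f : ℂ[X]} (hf : 0 < f.natDegree) (w : ℂ) :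
    ∃ z, f.eval z = w := by
  obtain ⟨z, hz⟩ := IsAlgClosed.exists_root (f - C w)
    (natDegree_pos_iff_degree_pos.1 (by rwa [natDegree_sub_C])).ne'
  exact ⟨z, sub_eq_zero.1 (by simpa using hz)⟩

theorem Polynomial.eq_C_mul_X_sub_C_pow {f : ℂ[X]} {ζ : ℂ} (h : ∀ z, f.IsRoot z → z = ζ) :
    f = C f.leadingCoeff * (X - C ζ) ^ f.natDegree := by
  have hs := (IsAlgClosed.splits f).eq_prod_roots
  rcases eq_or_ne f 0 with rfl | hf
  · simp
  have hr : f.roots = Multiset.replicate f.natDegree ζ :=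
    Multiset.eq_replicate.2 ⟨card_roots_eq_natDegree f, fun z hz => h z (isRoot_of_mem_roots hz)⟩
  rw [hr, Multiset.map_replicate, Multiset.prod_replicate] at hs
  exact hs

theorem mem_filledJuliaSet_of_fixed {f : ℂ[X]} {z : ℂ} (hz : f.eval z = z) :
    z ∈ filledJuliaSet f := by
  refine (mem_filledJuliaSet_iff_exists_bound f z).2 ⟨‖z‖, fun k => ?_⟩
  rw [Function.iterate_fixed (f := fun w : ℂ => f.eval w) hz]

/-- If K were {ζ}, then f - X and f - ζ would both have ζ as their only root, with equal degree and
leading coefficient; they would coincide. -/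
theorem filledJuliaSet_nontrivial {f : ℂ[X]} (hf : 2 ≤ f.natDegree) :
    (filledJuliaSet f).Nontrivial := by
  have hd : (f - X).natDegree = f.natDegree :=
    natDegree_sub_eq_left_of_natDegree_lt (by rw [natDegree_X]; omega)
  obtain ⟨ζ, hζ⟩ := exists_eval_eq (f := f - X) (by omega) 0
  have hζ' : f.eval ζ = ζ := sub_eq_zero.1 (by simpa using hζ)
  have hζK := mem_filledJuliaSet_of_fixed hζ'
  by_contra hcon
  have hall : ∀ z ∈ filledJuliaSet f, z = ζ := fun z hz =>
    (Set.not_nontrivial_iff.1 hcon) hz hζK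
  have h1 := eq_C_mul_X_sub_C_pow (f := f - X) (ζ := ζ) fun z hz =>
    hall z (mem_filledJuliaSet_of_fixed (sub_eq_zero.1 (by simpa using hz)))
  have h2 := eq_C_mul_X_sub_C_pow (f := f - C ζ) (ζ := ζ) fun z hz => by
    have hz' : f.eval z = ζ := sub_eq_zero.1 (by simpa using hz)
    exact hall z ((eval_mem_filledJuliaSet f z).1 (by rwa [hz']))
  have hl1 : (f - X).leadingCoeff = f.leadingCoeff := by
    rw [leadingCoeff, hd, coeff_sub, coeff_X_of_ne_one (by omega), sub_zero, leadingCoeff]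
  have hl2 : (f - C ζ).leadingCoeff = f.leadingCoeff := by
    rw [leadingCoeff, natDegree_sub_C, coeff_sub, coeff_C_of_ne_zero (by omega), sub_zero,
      leadingCoeff]
  rw [hl1, hd] at h1
  rw [hl2, natDegree_sub_C, ← h1] at h2
  have h3 : (X : ℂ[X]) = C ζ := (sub_right_injective h2).symm
  exact X_ne_C ζ h3

/-! ### Rotational symmetries and equality of Julia sets. -/

theorem Polynomial.coeff_comp_linear_of_nextCoeff_eq_zero {f : ℂ[X]} (hf : 2 ≤ f.natDegree)
    (h : f.nextCoeff = 0) (c d : ℂ) :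
    (f.comp (C c * X + C d)).coeff (f.natDegree - 1) =
      f.leadingCoeff * (f.natDegree * c ^ (f.natDegree - 1) * d) := by
  have hlow : f.eraseLead.natDegree < f.natDegree - 1 := by
    refine lt_of_le_of_ne (eraseLead_natDegree_le f) fun heq => ?_
    have h0 : f.eraseLead.coeff (f.natDegree - 1) = 0 := by
      rw [eraseLead_coeff_of_ne _ (by omega), ← nextCoeff_of_natDegree_pos (by omega), h]
    rw [← heq, coeff_natDegree, leadingCoeff_eq_zero] at h0
    rw [h0, natDegree_zero] at heq
    omega
  have hlow' : (f.eraseLead.comp (C c * X + C d)).coeff (f.natDegree - 1) = 0 := by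
    refine coeff_eq_zero_of_natDegree_lt (natDegree_comp_le.trans_lt ?_)
    have : f.eraseLead.natDegree * (C c * X + C d).natDegree ≤ f.eraseLead.natDegree * 1 :=
      Nat.mul_le_mul_left _ natDegree_linear_le
    omega
  have hpow : (C c * X + C d : ℂ[X]) ^ f.natDegree =
      ((X + C d) ^ f.natDegree).comp (C c * X) := by simp
  have hsplit : f.comp (C c * X + C d) =
      f.eraseLead.comp (C c * X + C d) + C f.leadingCoeff * (C c * X + C d) ^ f.natDegree := by
    conv_lhs => rw [← f.eraseLead_add_C_mul_X_pow]
    simp only [add_comp, mul_comp, C_comp, pow_comp, X_comp]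
  rw [hsplit, coeff_add, hlow', zero_add, coeff_C_mul, hpow,
    comp_C_mul_X_coeff, coeff_X_add_C_pow, Nat.sub_sub_self (by omega), pow_one,
    Nat.choose_symm (by omega : 1 ≤ f.natDegree), Nat.choose_one_right]
  ring

theorem mem_rotationalSymmetries_of_filledJuliaSet {f : ℂ[X]} {c : ℂ} (hc : c ≠ 0)
    (h : ∀ z, c * z ∈ filledJuliaSet f ↔ z ∈ filledJuliaSet f) : c ∈ rotationalSymmetries f := by
  have him : (Homeomorph.mulLeft₀ c hc) '' filledJuliaSet f = filledJuliaSet f := by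
    ext z
    constructor
    · rintro ⟨w, hw, rfl⟩
      exact (h w).2 hw
    · intro hz
      refine ⟨c⁻¹ * z, (h _).1 ?_, ?_⟩
      · rwa [mul_inv_cancel_left₀ hc]
      · simp [mul_inv_cancel_left₀ hc]
  have := (Homeomorph.mulLeft₀ c hc).image_frontier (filledJuliaSet f)
  rw [him] at this
  exact this

theorem eq_C_mul_of_juliaSet_eq {f g : ℂ[X]} (hf : 2 ≤ f.natDegree) (hcent : IsCentered f)
    (hg : g.natDegree = f.natDegree) (hJ : juliaSet f = juliaSet g) :
    g = C (g.leadingCoeff / f.leadingCoeff) * f ∧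
      g.leadingCoeff / f.leadingCoeff ∈ rotationalSymmetries f := by
  have hK := filledJuliaSet_eq_of_juliaSet_eq hf (hg ▸ hf) hJ
  obtain ⟨ζ, -, hζ⟩ := exists_center_of_preimage_eq (isCompact_filledJuliaSet hf)
    (filledJuliaSet_nontrivial hf)
  have hfK := eval_mem_filledJuliaSet f
  have hgK := eval_mem_filledJuliaSet g
  rw [← hK] at hgK
  obtain ⟨hnorm, hgf⟩ := hζ f g (by omega) hg hfK hgK
  set c := g.leadingCoeff / f.leadingCoeff with hcdef
  have hc : c ≠ 0 := by rintro h; simp [h] at hnorm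
  set d := (1 - c) * ζ with hd
  have hgf' : g = C c * f + C d := by
    rw [hd, C_mul, C_sub, C_1]
    linear_combination hgf
  -- Write w = f(z), so that cw + d = g(z); both are in K exactly when z is.
  have hT : ∀ w, c * w + d ∈ filledJuliaSet f ↔ w ∈ filledJuliaSet f := by
    intro w
    obtain ⟨z, rfl⟩ := exists_eval_eq (f := f) (by omega) w
    rw [hfK z, ← hgK z, hgf']
    simp
  have hd0 : d = 0 := by
    have hdeg : (f.comp (C c * X + C d)).natDegree = f.natDegree := by
      rw [natDegree_comp, natDegree_linear hc, mul_one]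
    obtain ⟨-, h⟩ := hζ f (f.comp (C c * X + C d)) (by omega) hdeg hfK fun z => by
      rw [eval_comp, hfK]
      simpa using hT z
    have h' := congrArg (fun p => coeff p (f.natDegree - 1)) h
    have hnext : f.coeff (f.natDegree - 1) = 0 := by
      rw [← nextCoeff_of_natDegree_pos (by omega)]
      exact hcent
    have hn : (f.natDegree : ℂ) ≠ 0 := by exact_mod_cast (by omega : f.natDegree ≠ 0)
    have hlc : f.leadingCoeff ≠ 0 := leadingCoeff_ne_zero.2 (by rintro rfl; simp at hf)
    simp only [coeff_C_mul, coeff_sub] at h'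
    rw [coeff_C_of_ne_zero (by omega), hnext, coeff_comp_linear_of_nextCoeff_eq_zero hf hcent] at h'
    simpa [hn, hlc, hc] using h'
  refine ⟨by simpa [hd0] using hgf', mem_rotationalSymmetries_of_filledJuliaSet hc fun z => ?_⟩
  simpa [hd0] using hT z

theorem ne_zero_of_mem_rotationalSymmetries {f : ℂ[X]} (hf : 2 ≤ f.natDegree) {c : ℂ}
    (hc : c ∈ rotationalSymmetries f) : c ≠ 0 := by
  rintro rfl
  have h : ∀ z ∈ juliaSet f, ‖z‖ ≤ 0 := by
    intro z hz
    rw [← show (fun z : ℂ => 0 * z) '' juliaSet f = juliaSet f from hc] at hz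
    obtain ⟨w, -, rfl⟩ := hz
    simp
  have h0 : ∀ z ∈ filledJuliaSet f, z = 0 := fun z hz =>
    norm_le_zero_iff.1 (norm_le_of_forall_mem_juliaSet hf (p := fun z => z) differentiable_id h hz)
  obtain ⟨u, hu, v, hv, huv⟩ := filledJuliaSet_nontrivial hf
  exact huv ((h0 u hu).trans (h0 v hv).symm)

theorem mul_mem_filledJuliaSet_iff {f : ℂ[X]} (hf : 2 ≤ f.natDegree) {c : ℂ}
    (hc : c ∈ rotationalSymmetries f) (z : ℂ) :
    c * z ∈ filledJuliaSet f ↔ z ∈ filledJuliaSet f := by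
  have hc0 := ne_zero_of_mem_rotationalSymmetries hf hc
  have hcJ : (fun z : ℂ => c * z) '' juliaSet f = juliaSet f := hc
  have hJK := juliaSet_subset_filledJuliaSet hf
  refine ⟨fun h => ?_, fun h => ?_⟩
  · rw [← inv_mul_cancel_left₀ hc0 z]
    refine mem_filledJuliaSet_of_forall_mem_juliaSet hf hf (fun w hw => hJK ?_) h
    rw [← hcJ] at hw
    obtain ⟨v, hv, rfl⟩ := hw
    rwa [inv_mul_cancel_left₀ hc0]
  · exact mem_filledJuliaSet_of_forall_mem_juliaSet hf hf
      (fun w hw => hJK (hcJ ▸ Set.mem_image_of_mem _ hw)) h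

theorem filledJuliaSet_C_mul {f : ℂ[X]} {c : ℂ} {n : ℕ} (hc : ‖c‖ = 1)
    (h : ∀ z, f.eval (c * z) = c ^ n * f.eval z) :
    filledJuliaSet (C c * f) = filledJuliaSet f := by
  have hpow : ∀ m z, f.eval (c ^ m * z) = (c ^ n) ^ m * f.eval z := by
    intro m
    induction m with
    | zero => simp
    | succ m ih => intro z; rw [pow_succ, mul_assoc, ih, h, pow_succ, mul_assoc]
  have hit : ∀ (z : ℂ) (k : ℕ), ∃ m : ℕ,
      (fun w : ℂ => (C c * f).eval w)^[k] z = c ^ m * (fun w : ℂ => f.eval w)^[k] z := by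
    intro z k
    induction k with
    | zero => exact ⟨0, by simp⟩
    | succ k ih =>
      obtain ⟨m, hm⟩ := ih
      -- f turns the factor c^m into c^{nm}, and the outer multiplication adds one.
      refine ⟨1 + n * m, ?_⟩
      rw [Function.iterate_succ_apply', Function.iterate_succ_apply', hm, eval_mul, eval_C, hpow]
      ring
  ext z
  rw [mem_filledJuliaSet_iff_exists_bound, mem_filledJuliaSet_iff_exists_bound]
  refine exists_congr fun M => forall_congr' fun k => ?_
  obtain ⟨m, hm⟩ := hit z k
  rw [hm, norm_mul, norm_pow, hc, one_pow, one_mul]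

theorem juliaSet_C_mul_of_mem_rotationalSymmetries {f : ℂ[X]} (hf : 2 ≤ f.natDegree) {c : ℂ}
    (hc : c ∈ rotationalSymmetries f) : juliaSet (C c * f) = juliaSet f := by
  have hc0 := ne_zero_of_mem_rotationalSymmetries hf hc
  have hcK := mul_mem_filledJuliaSet_iff hf hc
  have hfK := eval_mem_filledJuliaSet f
  have hlc : f.leadingCoeff ≠ 0 := leadingCoeff_ne_zero.2 (by rintro rfl; simp at hf)
  obtain ⟨ζ, hfix, hζ⟩ := exists_center_of_preimage_eq (isCompact_filledJuliaSet hf)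
    (filledJuliaSet_nontrivial hf)
  obtain ⟨hnorm, heq⟩ := hζ f (f.comp (C c * X)) (by omega)
    (by rw [natDegree_comp, natDegree_C_mul_X c hc0, mul_one]) hfK
    (fun z => by rw [eval_comp, hfK]; simpa using hcK z)
  have hratio : (f.comp (C c * X)).leadingCoeff / f.leadingCoeff = c ^ f.natDegree := by
    rw [leadingCoeff_comp (by rw [natDegree_C_mul_X c hc0]; exact one_ne_zero),
      leadingCoeff_C_mul_X, mul_div_cancel_left₀ _ hlc]
  rw [hratio] at hnorm heq
  have hc1 : ‖c‖ = 1 := by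
    rw [norm_pow] at hnorm
    exact (pow_eq_one_iff_of_nonneg (norm_nonneg c) (by omega)).1 hnorm
  have hcζ : ∀ m : ℕ, c ^ m * ζ = ζ := by
    intro m
    induction m with
    | zero => simp
    | succ m ih => rw [pow_succ, mul_assoc, hfix c hc1 fun w hw => (hcK w).2 hw, ih]
  have hsym : ∀ z, f.eval (c * z) = c ^ f.natDegree * f.eval z := by
    intro z
    have h := congrArg (eval z) heq
    simp only [eval_sub, eval_comp, eval_mul, eval_C, eval_X] at h
    linear_combination h - hcζ f.natDegree
  rw [juliaSet, filledJuliaSet_C_mul hc1 hsym, juliaSet]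

theorem proposition6 (n : ℕ) (hn : 2 ≤ n) (f : Polynomial ℂ) (hf : f.natDegree = n)
    (hcent : IsCentered f) :
    (∀ g : Polynomial ℂ, g.natDegree = n → juliaSet f = juliaSet g →
      g = Polynomial.C (g.leadingCoeff / f.leadingCoeff) * f ∧
        g.leadingCoeff / f.leadingCoeff ∈ rotationalSymmetries f) ∧
    sameJuliaOfDegree f n = {g | ∃ σ ∈ rotationalSymmetries f, g = Polynomial.C σ * f} := by
  subst hf
  have key := fun g hg hJ => eq_C_mul_of_juliaSet_eq (g := g) hn hcent hg hJ
  refine ⟨key, Set.ext fun g => ⟨fun hg => ?_, ?_⟩⟩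
  · obtain ⟨h₁, h₂⟩ := key g hg.1 hg.2.symm
    exact ⟨_, h₂, h₁⟩
  · rintro ⟨σ, hσ, rfl⟩
    exact ⟨natDegree_C_mul (ne_zero_of_mem_rotationalSymmetries hn hσ),
      juliaSet_C_mul_of_mem_rotationalSymmetries hn hσ⟩
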